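/- A \emph{data set} $(\mathfrak g,\mathfrak v,\pi)$ consists of a finite-dimensional real Lie algebra $\mathfrak g$ with a non-degenerate symmetric bilinear form $\langle\cdot,\cdot\rangle_{\mathfrak g}$ for which every $\operatorname{ad}(Z)$, $Z\in\mathfrak g$, is skew-symmetric, a finite-dimensional real vector space $\mathfrak v$ with a non-degenerate symmetric bilinear form $\langle\cdot,\cdot\rangle_{\mathfrak v}$, and a faithful representation $\pi:\mathfrak g\to\mathfrak{so}(\mathfrak v,\langle\cdot,\cdot\rangle_{\mathfrak v})$ with $\bigcap_{Z\in\mathfrak g}\ker\pi(Z)=\{0\}$. Let $\mathfrak n=\mathfrak n(\mathfrak g,\mathfrak v,\pi)$ be the vector space $\mathfrak g\oplus\mathfrak v$ with the metric $\langle\cdot,\cdot\rangle=\langle\cdot,\cdot\rangle_{\mathfrak g}\oplus\langle\cdot,\cdot\rangle_{\mathfrak v}$ (so that $\mathfrak g\perp\mathfrak v$) and the Lie bracket given by $[\mathfrak g,\mathfrak n]_{\mathfrak n}=0$, $[\mathfrak v,\mathfrak v]_{\mathfrak n}\subset\mathfrak g$ and $\langle[X,Y]_{\mathfrak n},Z\rangle=\langle\pi(Z)X,Y\rangle$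 for $X,Y\in\mathfrak v$, $Z\in\mathfrak g$. The data set is \emph{Lorentzian} if $\langle\cdot,\cdot\rangle$ has signature one, i.e. the maximal dimension of a negative definite subspace of $\mathfrak n$ is $1$. Let $\mathfrak h^{\mathrm{aut}}=\operatorname{Der}(\mathfrak n)\cap\mathfrak{so}(\mathfrak n)\subset\operatorname{End}(\mathfrak n)$ be the Lie algebra of skew-symmetric derivations of $\mathfrak n$. \textbf{Theorem.} Let $(\mathfrak g,\mathfrak v,\pi)$ be a Lorentzian data set, let $\overline{\mathfrak g}=[\mathfrak g,\mathfrak g]$, and let $\mathfrak c$ be the center of $\mathfrak g$. Then $\mathfrak g=\overline{\mathfrak g}\oplus\mathfrak c$, and $\overline{\mathfrak g}$ is compact (it admits an $\operatorname{ad}$-invariant positive definite inner product) and semisimple (possibly zero). Put $$\mathfrak u=\{B\in\mathfrak{so}(\mathfrak v,\langle\cdot,\cdot\rangle_{\mathfrak v}) : [B,\pi(Z)]=0 \text{ for every } Z\in\mathfrak g\}.$$ For $Z\in\overline{\mathfrak g}$ the endomorphism $\varphi(Z)=(\operatorname{ad}(Z),\pi(Z))$ of $\mathfrak n=\mathfrak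 g\oplus\mathfrak v$ lies in $\mathfrak h^{\mathrm{aut}}$, and for $B\in\mathfrak u$ the endomorphism $\psi(B)=(0,B)$ lies in $\mathfrak h^{\mathrm{aut}}$; the maps $\varphi:\overline{\mathfrak g}\to\mathfrak h^{\mathrm{aut}}$ and $\psi:\mathfrak u\to\mathfrak h^{\mathrm{aut}}$ are injective Lie algebra homomorphisms, their images are ideals of $\mathfrak h^{\mathrm{aut}}$, and $$\mathfrak h^{\mathrm{aut}}=\varphi(\overline{\mathfrak g})\oplus\psi(\mathfrak u),\qquad [\varphi(\overline{\mathfrak g}),\psi(\mathfrak u)]=0 .$$ -/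

import Mathlib

attribute [local instance 100] LieRing.ofAssociativeRing

noncomputable section

/-- A data set `(𝔤, 𝔳, π)`: non-degenerate symmetric bilinear forms on a real Lie algebra `𝔤` and on a
real vector space `𝔳`, and a faithful representation `π` of `𝔤` on `𝔳` without trivial
subrepresentations, such that all `ad Z` and all `π Z` are skew-symmetric. -/
structure DataSet (𝔤 𝔳 : Type*) [LieRing 𝔤] [LieAlgebra ℝ 𝔤] [AddCommGroup 𝔳] [Module ℝ 𝔳] where
  /-- the metric on `𝔤` -/
  metricG : LinearMap.BilinForm ℝ 𝔤
  metricG_symm : metricG.IsSymm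
  metricG_nondegenerate : metricG.Nondegenerate
  /-- `ad Z` is skew-symmetric -/
  metricG_ad : ∀ Z Z₁ Z₂ : 𝔤, metricG ⁅Z, Z₁⁆ Z₂ = -metricG Z₁ ⁅Z, Z₂⁆
  /-- the metric on `𝔳` -/
  metricV : LinearMap.BilinForm ℝ 𝔳
  metricV_symm : metricV.IsSymm
  metricV_nondegenerate : metricV.Nondegenerate
  /-- the representation -/
  π : 𝔤 →ₗ⁅ℝ⁆ Module.End ℝ 𝔳
  faithful : Function.Injective π
  /-- no trivial subrepresentations -/
  iInf_ker : ⨅ Z : 𝔤, LinearMap.ker (π Z) = ⊥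
  /-- `π Z` is skew-symmetric -/
  metricV_π : ∀ (Z : 𝔤) (X Y : 𝔳), metricV (π Z X) Y = -metricV X (π Z Y)

namespace DataSet

variable {𝔤 𝔳 : Type*} [LieRing 𝔤] [LieAlgebra ℝ 𝔤]
  [AddCommGroup 𝔳] [Module ℝ 𝔳] (D : DataSet 𝔤 𝔳)

/-- The underlying space `𝔤 ⊕ 𝔳` of the Lie algebra `𝔫(𝔤, 𝔳, π)`. -/
def Nil (_D : DataSet 𝔤 𝔳) : Type _ := 𝔤 × 𝔳

instance : AddCommGroup D.Nil := inferInstanceAs (AddCommGroup (𝔤 × 𝔳))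

instance : Module ℝ D.Nil := inferInstanceAs (Module ℝ (𝔤 × 𝔳))

/-- `𝔫(𝔤, 𝔳, π)` is, as a vector space, `𝔤 × 𝔳`. -/
def equivProd : D.Nil ≃ₗ[ℝ] 𝔤 × 𝔳 := LinearEquiv.refl ℝ (𝔤 × 𝔳)

/-- The element `Z + X` of `𝔫 = 𝔤 ⊕ 𝔳`. -/
def vec (Z : 𝔤) (X : 𝔳) : D.Nil := D.equivProd.symm (Z, X)

/-- The metric on `𝔫 = 𝔤 ⊕ 𝔳` for which `𝔤` and `𝔳` are orthogonal. -/
def metric : LinearMap.BilinForm ℝ D.Nil :=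
  D.metricG.compl₁₂ (LinearMap.fst ℝ 𝔤 𝔳 ∘ₗ D.equivProd.toLinearMap)
      (LinearMap.fst ℝ 𝔤 𝔳 ∘ₗ D.equivProd.toLinearMap) +
    D.metricV.compl₁₂ (LinearMap.snd ℝ 𝔤 𝔳 ∘ₗ D.equivProd.toLinearMap)
      (LinearMap.snd ℝ 𝔤 𝔳 ∘ₗ D.equivProd.toLinearMap)

theorem metric_vec (Z Z' : 𝔤) (X X' : 𝔳) :
    D.metric (D.vec Z X) (D.vec Z' X') = D.metricG Z Z' + D.metricV X X' := by
  simp [metric, vec]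

/-- The metric on `𝔫` has signature one: the maximal dimension of a negative definite subspace
is one. -/
def IsLorentzian : Prop :=
  sigNeg D.metric.toQuadraticMap = 1

/-- `𝔲 = End_π(𝔳) ∩ 𝔰𝔬(𝔳)`. -/
def u : LieSubalgebra ℝ (Module.End ℝ 𝔳) where
  __ := Subalgebra.toSubmodule (Subalgebra.centralizer ℝ (Set.range D.π)) ⊓
    (skewAdjointLieSubalgebra D.metricV).toSubmodule
  lie_mem' := by
    rintro A B ⟨hA, hA'⟩ ⟨hB, hB'⟩
    refine ⟨?_, (skewAdjointLieSubalgebra D.metricV).lie_mem hA' hB'⟩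
    exact Subalgebra.sub_mem _ (Subalgebra.mul_mem _ hA hB) (Subalgebra.mul_mem _ hB hA)

variable [FiniteDimensional ℝ 𝔤]

/-- The bracket `𝔳 × 𝔳 → 𝔤` determined by `⟨[X, Y], Z⟩ = ⟨π(Z) X, Y⟩` for all `Z`. -/
def bracketV (X Y : 𝔳) : 𝔤 :=
  (D.metricG.toDual D.metricG_nondegenerate).symm
    ((D.metricV.flip Y) ∘ₗ (LinearMap.applyₗ X) ∘ₗ (D.π : 𝔤 →ₗ[ℝ] Module.End ℝ 𝔳))

theorem metricG_bracketV (X Y : 𝔳) (Z : 𝔤) :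
    D.metricG (D.bracketV X Y) Z = D.metricV (D.π Z X) Y := by
  simp [bracketV, LinearMap.BilinForm.apply_toDual_symm_apply]

theorem ext_metricG {Z₁ Z₂ : 𝔤} (h : ∀ W, D.metricG Z₁ W = D.metricG Z₂ W) : Z₁ = Z₂ :=
  (D.metricG.toDual D.metricG_nondegenerate).injective (LinearMap.ext h)

theorem bracketV_add_left (X X' Y : 𝔳) :
    D.bracketV (X + X') Y = D.bracketV X Y + D.bracketV X' Y :=
  D.ext_metricG fun W => by simp [metricG_bracketV]

theorem bracketV_add_right (X Y Y' : 𝔳) :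
    D.bracketV X (Y + Y') = D.bracketV X Y + D.bracketV X Y' :=
  D.ext_metricG fun W => by simp [metricG_bracketV]

theorem bracketV_smul_right (t : ℝ) (X Y : 𝔳) :
    D.bracketV X (t • Y) = t • D.bracketV X Y :=
  D.ext_metricG fun W => by simp [metricG_bracketV]

theorem bracketV_self (X : 𝔳) : D.bracketV X X = 0 :=
  D.ext_metricG fun W => by
    have h := D.metricV_π W X X
    rw [D.metricV_symm.eq X (D.π W X)] at h
    rw [metricG_bracketV, map_zero, LinearMap.zero_apply]
    linarith

theorem bracketV_zero_right (X : 𝔳) : D.bracketV X 0 = 0 :=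
  D.ext_metricG fun W => by simp [metricG_bracketV]

theorem bracketV_zero_left (Y : 𝔳) : D.bracketV 0 Y = 0 :=
  D.ext_metricG fun W => by simp [metricG_bracketV]

/-- The bracket of `𝔫(𝔤, 𝔳, π)`: `[Z + X, Z' + X'] = [X, X'] ∈ 𝔤`. -/
instance : Bracket D.Nil D.Nil :=
  ⟨fun U W => D.vec (D.bracketV (D.equivProd U).2 (D.equivProd W).2) 0⟩

theorem lie_def (U W : D.Nil) :
    ⁅U, W⁆ = D.vec (D.bracketV (D.equivProd U).2 (D.equivProd W).2) 0 := rfl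

instance : LieRing D.Nil where
  add_lie U U' W := D.equivProd.injective <| by
    simp [lie_def, vec, bracketV_add_left]
  lie_add U W W' := D.equivProd.injective <| by
    simp [lie_def, vec, bracketV_add_right]
  lie_self U := D.equivProd.injective <| by
    simp [lie_def, vec, bracketV_self]
  leibniz_lie U W W' := D.equivProd.injective <| by
    simp [lie_def, vec, bracketV_zero_left, bracketV_zero_right]

instance : LieAlgebra ℝ D.Nil where
  lie_smul t U W := D.equivProd.injective <| by
    simp [lie_def, vec, bracketV_smul_right]

/-- `𝔥^aut = Der(𝔫) ∩ 𝔰𝔬(𝔫)`, the skew-symmetric derivations of `𝔫`. -/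
def hAut : LieSubalgebra ℝ (Module.End ℝ D.Nil) :=
  (LieDerivation.toLinearMapLieHom ℝ D.Nil).range ⊓ skewAdjointLieSubalgebra D.metric

end DataSet

/-- A real Lie algebra is compact if it admits an `ad`-invariant (positive definite) inner
product. -/
def IsCompactLieAlgebra (L : Type*) [LieRing L] [LieAlgebra ℝ L] : Prop :=
  ∃ B : LinearMap.BilinForm ℝ L, B.IsSymm ∧ (∀ Z : L, Z ≠ 0 → 0 < B Z Z) ∧
    ∀ Z Z₁ Z₂ : L, B ⁅Z, Z₁⁆ Z₂ = -B Z₁ ⁅Z, Z₂⁆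

/-- The derived algebra `[𝔤, 𝔤]`. -/
abbrev derivedAlgebra (L : Type*) [LieRing L] [LieAlgebra ℝ L] : LieIdeal ℝ L :=
  ⁅(⊤ : LieIdeal ℝ L), (⊤ : LieIdeal ℝ L)⁆

end

/-! Signature one enters only through the fact that of two orthogonal vectors at most one is
negative. If the form on `𝔤` is positive, it makes `𝔤` compact. Otherwise the negative direction
lies in `𝔤`, so `𝔳` is Euclidean and `-tr (π Z * π W)` is an invariant inner product. Compactness
gives the splitting of `𝔤` and the semisimplicity of its derived algebra.

A skew derivation is a block diagonal `(A, B)` with `π (A Z) = ⁅B, π Z⁆`, so `A` is a derivation of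
`𝔤` by faithfulness. The crux is that `A` kills the center (`IsLorentzian.apply_center_eq_zero`).
For central `Z`, the commutator `π (A Z)` commutes with all of `π 𝔤`, hence is nilpotent
(`isNilpotent_commutator_of_commute`). A form of index at most one leaves no room for such an
operator (`eq_zero_of_isNilpotent_of_skew`). Hence `A = ad W` with `W` in the derived algebra, and
`B - π W` lies in `𝔲`. -/

/-! ### Nilpotent commutators. -/

open Polynomial in
/-- If `B * M - M * B` commutes with `M` and `M` is algebraic, then `B * M - M * B` is nilpotent. -/
theorem isNilpotent_commutator_of_commute {A : Type*} [Ring A] [Algebra ℝ A] {B M : A}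
    (hM : IsIntegral ℝ M) (h : Commute (B * M - M * B) M) : IsNilpotent (B * M - M * B) := by
  set N := B * M - M * B with hN
  have hcomm (q : ℝ[X]) : Commute N (aeval M q) := by
    induction q using Polynomial.induction_on' with
    | add p q hp hq => simpa using hp.add_right hq
    | monomial n a =>
      rw [aeval_monomial]
      exact Commute.mul_right (Algebra.commutes a N).symm (h.pow_right n)
  have hpow (n : ℕ) : B * M ^ n = M ^ n * B + (n : A) * M ^ (n - 1) * N := by
    induction n with
    | zero => simp
    | succ n ih =>
      have e : B * M = M * B + N := by rw [hN]; abel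
      have e' : M ^ n * N = N * M ^ n := ((h.pow_right n).eq).symm
      rcases n with _ | n
      · simp [e]
      · rw [pow_succ' M (n + 1), ← mul_assoc, e, add_mul, mul_assoc, ih, ← e']
        simp only [Nat.add_sub_cancel, mul_add, mul_assoc]
        push_cast
        have e2 : M * ((n + 1 : A) * (M ^ n * N)) = (n + 1 : A) * (M ^ (n + 1) * N) := by
          rw [pow_succ', ← mul_assoc M, ← mul_assoc (n + 1 : A), ← mul_assoc (n + 1 : A)]
          have : M * (n + 1 : A) = (n + 1 : A) * M := by
            exact_mod_cast ((Nat.cast_commute (n + 1) M).eq).symm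
          rw [this]
          simp only [mul_assoc]
        rw [e2]
        simp only [add_mul, one_mul]
        abel
  -- Since `N` commutes with `M`, bracketing with `B` differentiates polynomials in `M`.
  have hder (q : ℝ[X]) : B * aeval M q = aeval M q * B + aeval M (derivative q) * N := by
    induction q using Polynomial.induction_on' with
    | add p q hp hq => simp only [map_add, mul_add, hp, hq, add_mul]; abel
    | monomial n a =>
      rw [derivative_monomial, aeval_monomial, aeval_monomial, ← mul_assoc,
        ← Algebra.commutes a B, mul_assoc, hpow]
      simp [mul_add, mul_assoc]
  -- Sandwiching `B * q(M)` between two factors `N ^ k` trades `q` for `q'` at the cost of the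
  -- exponent `2k + 1`; repeated differentiation ends at a nonzero constant.
  have key (d : ℕ) : ∀ (q : ℝ[X]) (k : ℕ), q.natDegree = d → q ≠ 0 → N ^ k * aeval M q = 0 →
      IsNilpotent N := by
    induction d with
    | zero =>
      intro q k hd hq hk
      obtain ⟨c, rfl⟩ := natDegree_eq_zero.1 hd
      have hc : c ≠ 0 := by rintro rfl; simp at hq
      rw [aeval_C, ← Algebra.commutes, ← Algebra.smul_def] at hk
      exact ⟨k, (smul_eq_zero_iff_right hc).1 hk⟩
    | succ d ih =>
      intro q k hd hq hk
      have hd' : (derivative q).natDegree = d := by rw [natDegree_derivative, hd]; rfl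
      refine ih (derivative q) (k + 1 + k) hd' (fun h0 ↦ ?_) ?_
      · have := derivative_eq_zero.1 h0
        omega
      · have hk' : aeval M q * N ^ k = 0 := by rw [← ((hcomm q).pow_left k).eq, hk]
        have h1 : N ^ k * (B * aeval M q) * N ^ k = 0 := by
          rw [mul_assoc, mul_assoc, hk', mul_zero, mul_zero]
        rw [hder, mul_add, ← mul_assoc, hk, zero_mul, zero_add, ← mul_assoc,
          ((hcomm _).pow_left k).eq, mul_assoc, mul_assoc] at h1
        rw [((hcomm _).pow_left _).eq, pow_add, pow_succ, mul_assoc, ← h1]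
  obtain ⟨p, hp, hp0⟩ := hM
  exact key _ p 0 rfl hp.ne_zero (by simpa [aeval_def] using hp0)

/-! ### Symmetric bilinear forms of index at most one. -/

namespace LinearMap.BilinForm

variable {V : Type*} [AddCommGroup V] [Module ℝ V] {b : LinearMap.BilinForm ℝ V}

/-- A null vector of a positive semidefinite form is orthogonal to everything. -/
theorem apply_eq_zero_of_nonneg_on (hs : b.IsSymm) {P : Submodule ℝ V}
    (hP : ∀ x ∈ P, 0 ≤ b x x) {s w : V} (hsP : s ∈ P) (hwP : w ∈ P) (h0 : b s s = 0) :
    b s w = 0 := by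
  by_contra hne
  -- The coefficient is chosen so that this vector has square `-1`.
  have h := hP (w + (-(b w w + 1) / (2 * b s w)) • s) (P.add_mem hwP (P.smul_mem _ hsP))
  have hr : -(b w w + 1) / (2 * b s w) * b s w = -(b w w + 1) / 2 := by field_simp
  simp only [map_add, LinearMap.add_apply, map_smul, LinearMap.smul_apply, smul_eq_mul, h0,
    hs.eq w s, hr] at h
  linarith

theorem pos_of_nonneg (hs : b.IsSymm) (hb : b.Nondegenerate) (h : ∀ x, 0 ≤ b x x) {x : V}
    (hx : x ≠ 0) : 0 < b x x :=
  lt_of_le_of_ne (h x) fun h0 ↦ hx <| hb.1 x fun _ ↦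
    apply_eq_zero_of_nonneg_on hs (P := ⊤) (fun z _ ↦ h z) trivial trivial h0.symm

theorem nondegenerate_of_pos (h : ∀ x, x ≠ 0 → 0 < b x x) : b.Nondegenerate :=
  ⟨fun x hx ↦ by_contra fun h0 ↦ (h x h0).ne' (hx x),
    fun x hx ↦ by_contra fun h0 ↦ (h x h0).ne' (hx x)⟩

/-- Orthogonal null vectors are proportional if the index of the form is at most one. -/
theorem exists_smul_of_isotropic (hs : b.IsSymm) (hb : b.Nondegenerate)
    (h1 : ∀ s t, b s t = 0 → b s s < 0 → 0 ≤ b t t) {a c : V} (ha : a ≠ 0) (haa : b a a = 0)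
    (hac : b a c = 0) (hcc : b c c = 0) : ∃ r : ℝ, c = r • a := by
  by_cases ht : ∃ t, b t t < 0
  · obtain ⟨t, ht⟩ := ht
    -- The form is semidefinite on the complement of `t`, so a null vector there is orthogonal to
    -- that complement and to `t`.
    have hdef (s : V) (hst : b t s = 0) (hss : b s s = 0) : s = 0 := by
      refine hb.1 s fun w ↦ ?_
      have hw := apply_eq_zero_of_nonneg_on hs (P := LinearMap.ker (b t))
        (fun x hx ↦ h1 t x hx ht) (s := s) (w := w - (b t w / b t t) • t) hst
        (by simp [ht.ne]) hss
      simpa [hs.eq s t, hst] using hw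
    have hta : b t a ≠ 0 := fun h0 ↦ ha (hdef a h0 haa)
    have hv := hdef (c - (b t c / b t a) • a) (by simp [hta])
      (by simp [haa, hac, hcc, hs.eq c a])
    exact ⟨_, sub_eq_zero.1 hv⟩
  · push Not at ht
    exact absurd haa (pos_of_nonneg hs hb ht ha).ne'

theorem apply_pow_of_skew {N : Module.End ℝ V} (hN : ∀ x y, b (N x) y = -b x (N y)) (k : ℕ)
    (x y : V) : b ((N ^ k) x) y = (-1) ^ k * b x ((N ^ k) y) := by
  induction k generalizing x y with
  | zero => simp
  | succ k ih =>
    rw [pow_succ' N, Module.End.mul_apply, hN, ih, ← Module.End.mul_apply, ← pow_succ, pow_succ']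
    ring

/-- Over a form of index at most one, a nilpotent skew endomorphism that commutes with a family of
skew endomorphisms without common kernel vanishes. -/
theorem eq_zero_of_isNilpotent_of_skew (hs : b.IsSymm) (hb : b.Nondegenerate)
    (h1 : ∀ s t, b s t = 0 → b s s < 0 → 0 ≤ b t t) {N : Module.End ℝ V}
    (hN : ∀ x y, b (N x) y = -b x (N y)) (hnil : IsNilpotent N) {S : Set (Module.End ℝ V)}
    (hS : ∀ T ∈ S, ∀ x y, b (T x) y = -b x (T y)) (hcomm : ∀ T ∈ S, Commute N T)
    (hker : ∀ x, (∀ T ∈ S, T x = 0) → x = 0) : N = 0 := by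
  classical
  by_contra hN0
  have hfind : ∃ k, N ^ (k + 1) = 0 := by
    obtain ⟨k, hk⟩ := hnil
    exact ⟨k, by rw [pow_succ, hk, zero_mul]⟩
  obtain ⟨k, hk, hk0⟩ : ∃ k, N ^ (k + 2) = 0 ∧ N ^ (k + 1) ≠ 0 := by
    have hs := Nat.find_spec hfind
    rcases hm : Nat.find hfind with _ | m
    · rw [hm] at hs
      exact absurd (by simpa using hs) hN0
    · rw [hm] at hs
      exact ⟨m, hs, Nat.find_min hfind (m := m) (by omega)⟩
  -- The last nonzero power of `N` has totally isotropic image, hence rank one. Each `T` acts on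
  -- this line by a scalar `r`, and skewness makes `b (T (P x)) y` equal to its own negative.
  set P := N ^ (k + 1) with hP
  have hPP (x : V) : P (P x) = 0 := by
    rw [← Module.End.mul_apply, hP, ← pow_add, show k + 1 + (k + 1) = k + 2 + k by ring, pow_add,
      hk, zero_mul, LinearMap.zero_apply]
  have hPadj := apply_pow_of_skew hN (k + 1)
  rw [← hP] at hPadj
  have hiso (x y : V) : b (P x) (P y) = 0 := by rw [hPadj, hPP, map_zero, mul_zero]
  obtain ⟨x, hx⟩ : ∃ x, P x ≠ 0 := by
    by_contra! hc
    exact hk0 (LinearMap.ext hc)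
  have hline (y : V) : ∃ r : ℝ, P y = r • P x :=
    exists_smul_of_isotropic hs hb h1 hx (hiso _ _) (hiso _ _) (hiso _ _)
  refine hx (hker _ fun T hT ↦ ?_)
  have hTP (y : V) : T (P y) = P (T y) :=
    (LinearMap.congr_fun ((hcomm T hT).pow_left (k + 1)).eq y).symm
  obtain ⟨r, hr⟩ := hline (T x)
  rw [← hTP] at hr
  refine hb.1 _ fun y ↦ ?_
  obtain ⟨m, hm⟩ := hline y
  have e1 : b (T (P x)) y = (-1) ^ (k + 1) * b (T x) (P y) := by rw [hTP, hPadj]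
  have e2 : b (T x) (P y) = -(r * b x (P y)) := by
    rw [hS T hT, hm, map_smul, hr, map_smul, map_smul, map_smul]
    simp only [smul_eq_mul]
    ring
  have e3 : b (T (P x)) y = r * ((-1) ^ (k + 1) * b x (P y)) := by
    rw [hr, map_smul, LinearMap.smul_apply, hPadj, smul_eq_mul]
  rw [e2] at e1
  linarith

/-- The trace form is negative on skew endomorphisms of a Euclidean space. -/
theorem trace_mul_self_neg_of_skew [FiniteDimensional ℝ V] (hs : b.IsSymm)
    (hb : ∀ x, x ≠ 0 → 0 < b x x) {N : Module.End ℝ V} (hN : ∀ x y, b (N x) y = -b x (N y))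
    (hN0 : N ≠ 0) : LinearMap.trace ℝ V (N * N) < 0 := by
  obtain ⟨v, hv⟩ := LinearMap.BilinForm.exists_orthogonal_basis
    (LinearMap.BilinForm.isSymm_iff.1 hs)
  have hnn (x : V) : 0 ≤ b x x := by
    rcases eq_or_ne x 0 with rfl | h
    · simp
    · exact (hb x h).le
  have hpos (i) : 0 < b (v i) (v i) := hb _ (v.ne_zero i)
  have hcoord (x : V) (i) : v.repr x i = b x (v i) / b (v i) (v i) := by
    rw [eq_div_iff (hpos i).ne']
    conv_rhs => rw [← v.sum_repr x]
    rw [map_sum, LinearMap.sum_apply, Finset.sum_eq_single i]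
    · simp
    · intro j _ hji
      rw [map_smul, LinearMap.smul_apply, hv hji, smul_zero]
    · simp
  have htr : LinearMap.trace ℝ V (N * N) = -∑ i, b (N (v i)) (N (v i)) / b (v i) (v i) := by
    rw [LinearMap.trace_eq_matrix_trace ℝ v, Matrix.trace, ← Finset.sum_neg_distrib]
    refine Finset.sum_congr rfl fun i _ ↦ ?_
    rw [Matrix.diag_apply, LinearMap.toMatrix_apply, hcoord, Module.End.mul_apply, hN, neg_div]
  rw [htr, neg_lt_zero]
  obtain ⟨i, hi⟩ : ∃ i, N (v i) ≠ 0 := by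
    by_contra! hc
    exact hN0 (v.ext hc)
  exact Finset.sum_pos' (fun j _ ↦ div_nonneg (hnn _) (hpos j).le)
    ⟨i, Finset.mem_univ _, div_pos (hb _ hi) (hpos i)⟩

end LinearMap.BilinForm

/-! ### Structure of compact Lie algebras. -/

section Compact

variable {L : Type*} [LieRing L] [LieAlgebra ℝ L]

theorem mem_center_iff {z : L} : z ∈ LieAlgebra.center ℝ L ↔ ∀ x : L, ⁅x, z⁆ = 0 :=
  LieModule.mem_maxTrivSubmodule ..

theorem derivedAlgebra_le_of_lie_mem {P : Submodule ℝ L} (h : ∀ x y : L, ⁅x, y⁆ ∈ P) {z : L}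
    (hz : z ∈ derivedAlgebra L) : z ∈ P := by
  rw [← LieSubmodule.mem_toSubmodule, LieSubmodule.lieIdeal_oper_eq_linear_span'] at hz
  refine Submodule.span_le.2 ?_ hz
  rintro _ ⟨x, -, y, -, rfl⟩
  exact h x y

theorem lie_mem_derivedAlgebra (x y : L) : ⁅x, y⁆ ∈ derivedAlgebra L :=
  LieSubmodule.lie_mem_lie (LieSubmodule.mem_top x) (LieSubmodule.mem_top y)

theorem IsCompactLieAlgebra.lieIdeal (h : IsCompactLieAlgebra L) (I : LieIdeal ℝ L) :
    IsCompactLieAlgebra I := by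
  obtain ⟨B, hs, hp, hi⟩ := h
  refine ⟨B.restrict I.toSubmodule, hs.restrict _, fun Z hZ ↦ ?_, fun Z Z₁ Z₂ ↦ ?_⟩
  · exact hp Z fun h0 ↦ hZ (Subtype.ext h0)
  · exact hi Z Z₁ Z₂

/-- By invariance the center is the orthogonal complement of the derived algebra, and definiteness
makes that a direct complement. -/
theorem IsCompactLieAlgebra.isCompl [FiniteDimensional ℝ L] (h : IsCompactLieAlgebra L) :
    IsCompl (derivedAlgebra L) (LieAlgebra.center ℝ L) := by
  obtain ⟨B, hs, hp, hi⟩ := h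
  have horth {z c : L} (hz : z ∈ derivedAlgebra L) (hc : c ∈ LieAlgebra.center ℝ L) :
      B c z = 0 := by
    refine derivedAlgebra_le_of_lie_mem (P := LinearMap.ker (B c)) (fun x y ↦ ?_) hz
    have := hi x c y
    rw [mem_center_iff] at hc
    rw [hc x] at this
    simpa using this.symm
  have hnd : (B.restrict (derivedAlgebra L).toSubmodule).Nondegenerate :=
    LinearMap.BilinForm.nondegenerate_of_pos fun x hx ↦ hp x fun h0 ↦ hx (Subtype.ext h0)
  rw [← LieSubmodule.isCompl_toSubmodule]
  have hc := LinearMap.BilinForm.isCompl_orthogonal_of_restrict_nondegenerate hs.isRefl hnd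
  have heq : B.orthogonal (derivedAlgebra L).toSubmodule =
      (LieAlgebra.center ℝ L).toSubmodule := by
    refine le_antisymm (fun z hz ↦ ?_) fun z hz ↦ ?_
    · rw [LieSubmodule.mem_toSubmodule, mem_center_iff]
      intro x
      by_contra h0
      refine (hp _ h0).ne' ?_
      rw [hi, hs.eq, hz _ (lie_mem_derivedAlgebra _ _), neg_zero]
    · intro x hx
      rw [hs.eq]
      exact horth hx hz
  rwa [heq] at hc

/-- Abelian ideals are central: if `x` lies in one, then `⁅x, ⁅x, y⁆⁆ = 0`, so invariance gives `⁅x,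
y⁆` square zero. -/
theorem IsCompactLieAlgebra.isSemisimple [FiniteDimensional ℝ L] (h : IsCompactLieAlgebra L)
    (hc : LieAlgebra.center ℝ L = ⊥) : LieAlgebra.IsSemisimple ℝ L := by
  obtain ⟨B, hs, hp, hi⟩ := h
  refine LieAlgebra.InvariantForm.isSemisimple_of_nondegenerate B
    (LinearMap.BilinForm.nondegenerate_of_pos hp) hi hs.isRefl fun I hI hab ↦ hI.1 ?_
  rw [eq_bot_iff, ← hc]
  intro x hx
  rw [mem_center_iff]
  intro y
  by_contra h0
  refine (hp _ h0).ne' ?_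
  have hyx : ⁅y, x⁆ ∈ I := lie_mem_right ℝ L I y x hx
  have h2 : ⁅x, ⁅y, x⁆⁆ = 0 := congrArg Subtype.val (hab.trivial (⟨x, hx⟩ : I) ⟨_, hyx⟩)
  have h3 : ⁅x, ⁅x, y⁆⁆ = 0 := by rw [← lie_skew x y, lie_neg, h2, neg_zero]
  rw [← lie_skew y x, map_neg, map_neg, LinearMap.neg_apply, neg_neg, hi, h3, map_zero, neg_zero]

theorem center_derivedAlgebra_eq_bot
    (h : IsCompl (derivedAlgebra L) (LieAlgebra.center ℝ L)) :
    LieAlgebra.center ℝ (derivedAlgebra L) = ⊥ := by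
  rw [eq_bot_iff]
  intro x hx
  rw [mem_center_iff] at hx
  rw [LieSubmodule.mem_bot]
  suffices hx0 : (x : L) ∈ (⊥ : LieIdeal ℝ L) from Subtype.ext ((LieSubmodule.mem_bot _).1 hx0)
  rw [← h.inf_eq_bot, LieSubmodule.mem_inf]
  refine ⟨x.2, ?_⟩
  rw [mem_center_iff]
  intro w
  have hw : w ∈ derivedAlgebra L ⊔ LieAlgebra.center ℝ L := by rw [h.sup_eq_top]; trivial
  obtain ⟨d, hd, c, hc, rfl⟩ := (LieSubmodule.mem_sup _ _ _).1 hw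
  rw [mem_center_iff] at hc
  have h1 : ⁅d, (x : L)⁆ = 0 := congrArg Subtype.val (hx ⟨d, hd⟩)
  rw [add_lie, h1, zero_add, ← lie_skew, hc, neg_zero]

theorem IsCompactLieAlgebra.isSemisimple_derivedAlgebra [FiniteDimensional ℝ L]
    (h : IsCompactLieAlgebra L) : LieAlgebra.IsSemisimple ℝ (derivedAlgebra L) :=
  (h.lieIdeal _).isSemisimple (center_derivedAlgebra_eq_bot h.isCompl)

/-- A derivation of a compact Lie algebra that vanishes on the center is inner. -/
theorem IsCompactLieAlgebra.exists_eq_lie [FiniteDimensional ℝ L] (h : IsCompactLieAlgebra L)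
    (A : Module.End ℝ L) (hA : ∀ x y, A ⁅x, y⁆ = ⁅A x, y⁆ + ⁅x, A y⁆)
    (hc : ∀ z ∈ LieAlgebra.center ℝ L, A z = 0) :
    ∃ w ∈ derivedAlgebra L, ∀ x, A x = ⁅w, x⁆ := by
  have hss := h.isSemisimple_derivedAlgebra
  have hmem (z : L) (hz : z ∈ derivedAlgebra L) : A z ∈ derivedAlgebra L := by
    refine derivedAlgebra_le_of_lie_mem (P := (derivedAlgebra L).toSubmodule.comap A)
      (fun x y ↦ ?_) hz
    rw [Submodule.mem_comap, hA]
    exact add_mem (lie_mem_derivedAlgebra _ _) (lie_mem_derivedAlgebra _ _)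
  let δ : LieDerivation ℝ (derivedAlgebra L) (derivedAlgebra L) :=
    { toLinearMap := A.restrict (p := (derivedAlgebra L).toSubmodule) hmem
      leibniz' := fun x y ↦ Subtype.ext <| by
        change A ⁅(x : L), (y : L)⁆ = ⁅(x : L), A y⁆ - ⁅(y : L), A x⁆
        rw [hA, ← lie_skew (A x)]
        abel }
  -- Semisimplicity in characteristic zero makes the Killing form non-degenerate, so `δ` is inner.
  obtain ⟨w, hw⟩ := LieDerivation.IsKilling.exists_eq_ad δ
  refine ⟨w, w.2, fun x ↦ ?_⟩
  have hx : x ∈ derivedAlgebra L ⊔ LieAlgebra.center ℝ L := by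
    rw [h.isCompl.sup_eq_top]; trivial
  obtain ⟨d, hd, c, hcc, rfl⟩ := (LieSubmodule.mem_sup _ _ _).1 hx
  have h1 : A d = ⁅(w : L), d⁆ := by
    have h := LieDerivation.congr_fun hw ⟨d, hd⟩
    have h' := LinearMap.congr_fun (LieDerivation.coe_ad_apply_eq_ad_apply (R := ℝ) w) ⟨d, hd⟩
    rw [LieAlgebra.ad_apply] at h'
    replace h := h'.symm.trans h
    exact (congrArg Subtype.val h).symm
  have h2 : ⁅(w : L), c⁆ = 0 := mem_center_iff.1 hcc _
  rw [map_add, hc c hcc, lie_add, h1, h2]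

end Compact

/-! ### Skew-symmetric derivations of `𝔫`. -/

namespace DataSet

variable {𝔤 𝔳 : Type*} [LieRing 𝔤] [LieAlgebra ℝ 𝔤]
  [AddCommGroup 𝔳] [Module ℝ 𝔳] (D : DataSet 𝔤 𝔳)

theorem vec_equivProd (U : D.Nil) : D.vec (D.equivProd U).1 (D.equivProd U).2 = U := rfl

theorem vec_inj {Z Z' : 𝔤} {X X' : 𝔳} : D.vec Z X = D.vec Z' X' ↔ Z = Z' ∧ X = X' :=
  Prod.mk_inj

theorem vec_add (Z Z' : 𝔤) (X X' : 𝔳) :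
    D.vec (Z + Z') (X + X') = D.vec Z X + D.vec Z' X' := rfl

theorem vec_sub (Z Z' : 𝔤) (X X' : 𝔳) :
    D.vec (Z - Z') (X - X') = D.vec Z X - D.vec Z' X' := rfl

theorem vec_smul (t : ℝ) (Z : 𝔤) (X : 𝔳) : D.vec (t • Z) (t • X) = t • D.vec Z X := rfl

theorem vec_zero : D.vec 0 0 = 0 := rfl

/-- The block diagonal endomorphism `(A, B)` of `𝔫 = 𝔤 ⊕ 𝔳`. -/
def blockDiag (A : Module.End ℝ 𝔤) (B : Module.End ℝ 𝔳) : Module.End ℝ D.Nil :=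
  D.equivProd.symm.toLinearMap ∘ₗ A.prodMap B ∘ₗ D.equivProd.toLinearMap

theorem blockDiag_vec (A : Module.End ℝ 𝔤) (B : Module.End ℝ 𝔳) (Z : 𝔤) (X : 𝔳) :
    D.blockDiag A B (D.vec Z X) = D.vec (A Z) (B X) := rfl

theorem end_ext {S T : Module.End ℝ D.Nil} (h : ∀ Z X, S (D.vec Z X) = T (D.vec Z X)) : S = T :=
  LinearMap.ext fun U ↦ h (D.equivProd U).1 (D.equivProd U).2

theorem mem_u_iff {B : Module.End ℝ 𝔳} :
    B ∈ D.u ↔ (∀ Z, D.π Z * B = B * D.π Z) ∧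
      ∀ X Y, D.metricV (B X) Y = -D.metricV X (B Y) := by
  change (B ∈ Subalgebra.centralizer ℝ (Set.range D.π) ∧
    B ∈ LinearMap.skewAdjointSubmodule D.metricV) ↔ _
  rw [LinearMap.mem_skewAdjointSubmodule, Subalgebra.mem_centralizer_iff, Set.forall_mem_range]
  simp [LinearMap.IsSkewAdjoint, LinearMap.IsAdjointPair]

theorem eq_zero_of_forall_π {X : 𝔳} (h : ∀ Z, D.π Z X = 0) : X = 0 := by
  have : X ∈ ⨅ Z : 𝔤, LinearMap.ker (D.π Z) := by simpa [Submodule.mem_iInf] using h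
  rwa [D.iInf_ker, Submodule.mem_bot] at this

variable [FiniteDimensional ℝ 𝔤]

theorem lie_vec (Z Z' : 𝔤) (X X' : 𝔳) :
    ⁅D.vec Z X, D.vec Z' X'⁆ = D.vec (D.bracketV X X') 0 := rfl

theorem mem_hAut_iff_lie {T : Module.End ℝ D.Nil} :
    T ∈ D.hAut ↔ (∀ U W, T ⁅U, W⁆ = ⁅T U, W⁆ + ⁅U, T W⁆) ∧
      ∀ U W, D.metric (T U) W = -D.metric U (T W) := by
  change (T ∈ (LieDerivation.toLinearMapLieHom ℝ D.Nil).range ∧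
    T ∈ LinearMap.skewAdjointSubmodule D.metric) ↔ _
  rw [LinearMap.mem_skewAdjointSubmodule, LieHom.mem_range]
  refine and_congr ⟨?_, fun h ↦ ?_⟩
    (by simp [LinearMap.IsSkewAdjoint, LinearMap.IsAdjointPair])
  · rintro ⟨δ, rfl⟩ U W
    change δ ⁅U, W⁆ = ⁅δ U, W⁆ + ⁅U, δ W⁆
    rw [LieDerivation.apply_lie_eq_add, add_comm]
  · refine ⟨⟨T, fun U W ↦ ?_⟩, rfl⟩
    rw [h, ← lie_skew W (T U)]
    abel

/-- Pairing the Leibniz rule on `𝔳` with `Z` and moving `A` and `B` across the metrics turns it into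
the condition on `π`. -/
theorem blockDiag_mem_hAut_iff {A : Module.End ℝ 𝔤} {B : Module.End ℝ 𝔳} :
    D.blockDiag A B ∈ D.hAut ↔
      (∀ Z W, D.metricG (A Z) W = -D.metricG Z (A W)) ∧
      (∀ X Y, D.metricV (B X) Y = -D.metricV X (B Y)) ∧
      ∀ Z, D.π (A Z) = ⁅B, D.π Z⁆ := by
  rw [mem_hAut_iff_lie]
  constructor
  · rintro ⟨h1, h2⟩
    have hA (Z W : 𝔤) : D.metricG (A Z) W = -D.metricG Z (A W) := by
      simpa [blockDiag_vec, metric_vec] using h2 (D.vec Z 0) (D.vec W 0)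
    have hB (X Y : 𝔳) : D.metricV (B X) Y = -D.metricV X (B Y) := by
      simpa [blockDiag_vec, metric_vec] using h2 (D.vec 0 X) (D.vec 0 Y)
    refine ⟨hA, hB, fun Z ↦ LinearMap.ext fun X ↦ ?_⟩
    rw [← sub_eq_zero]
    refine D.metricV_nondegenerate.1 _ fun Y ↦ ?_
    have h3 := h1 (D.vec 0 X) (D.vec 0 Y)
    simp only [lie_vec, blockDiag_vec, map_zero, ← vec_add, vec_inj, add_zero, and_true] at h3
    have h4 := congrArg (fun W ↦ D.metricG W Z) h3
    simp only [hA, map_add, LinearMap.add_apply, metricG_bracketV] at h4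
    have h5 := hB (D.π Z X) Y
    simp only [LieRing.of_associative_ring_bracket, map_sub, LinearMap.sub_apply,
      Module.End.mul_apply]
    linarith
  · rintro ⟨hA, hB, hπ⟩
    refine ⟨fun U W ↦ ?_, fun U W ↦ ?_⟩
    · rw [← D.vec_equivProd U, ← D.vec_equivProd W]
      generalize (D.equivProd U).1 = Z, (D.equivProd U).2 = X, (D.equivProd W).1 = Z',
        (D.equivProd W).2 = Y
      simp only [lie_vec, blockDiag_vec, map_zero, ← vec_add, vec_inj, add_zero, and_true]
      refine D.ext_metricG fun V ↦ ?_
      have h5 := hB (D.π V X) Y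
      simp only [hA, map_add, LinearMap.add_apply, metricG_bracketV, hπ,
        LieRing.of_associative_ring_bracket, map_sub, LinearMap.sub_apply, Module.End.mul_apply]
      linarith
    · rw [← D.vec_equivProd U, ← D.vec_equivProd W]
      simp only [blockDiag_vec, metric_vec, hA, hB]
      ring

/-- Skew-symmetric derivations of `𝔫` preserve the decomposition `𝔫 = 𝔤 ⊕ 𝔳`. -/
theorem exists_blockDiag_of_mem_hAut {T : Module.End ℝ D.Nil} (hT : T ∈ D.hAut) :
    ∃ A B, T = D.blockDiag A B := by
  obtain ⟨h1, h2⟩ := D.mem_hAut_iff_lie.1 hT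
  -- A derivation preserves the center of `𝔫`, and a central vector has `𝔳`-part killed by all of `π
  -- 𝔤`.
  have hcenter (Z : 𝔤) : (D.equivProd (T (D.vec Z 0))).2 = 0 := by
    refine D.eq_zero_of_forall_π fun W ↦ D.metricV_nondegenerate.1 _ fun Y ↦ ?_
    have h3 := h1 (D.vec Z 0) (D.vec 0 Y)
    rw [← D.vec_equivProd (T (D.vec Z 0)), ← D.vec_equivProd (T (D.vec 0 Y))] at h3
    simp only [lie_vec, bracketV_zero_left, vec_zero, map_zero, add_zero] at h3
    have h4 := (D.vec_inj.1 (h3.symm.trans D.vec_zero.symm)).1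
    rw [← metricG_bracketV, h4]
    simp
  have horth (X : 𝔳) : (D.equivProd (T (D.vec 0 X))).1 = 0 := by
    refine D.metricG_nondegenerate.1 _ fun Z ↦ ?_
    have h3 := h2 (D.vec 0 X) (D.vec Z 0)
    rw [← D.vec_equivProd (T (D.vec Z 0)), ← D.vec_equivProd (T (D.vec 0 X)), hcenter] at h3
    simpa [metric_vec] using h3
  refine ⟨LinearMap.fst ℝ 𝔤 𝔳 ∘ₗ (D.equivProd.toLinearMap ∘ₗ T ∘ₗ D.equivProd.symm.toLinearMap) ∘ₗ
    LinearMap.inl ℝ 𝔤 𝔳, LinearMap.snd ℝ 𝔤 𝔳 ∘ₗ (D.equivProd.toLinearMap ∘ₗ T ∘ₗ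
      D.equivProd.symm.toLinearMap) ∘ₗ LinearMap.inr ℝ 𝔤 𝔳, D.end_ext fun Z X ↦ ?_⟩
  have hZ : T (D.vec Z 0) = D.vec (D.equivProd (T (D.vec Z 0))).1 0 := by
    simpa only [hcenter Z] using (D.vec_equivProd (T (D.vec Z 0))).symm
  have hX : T (D.vec 0 X) = D.vec 0 (D.equivProd (T (D.vec 0 X))).2 := by
    simpa only [horth X] using (D.vec_equivProd (T (D.vec 0 X))).symm
  have hsum : D.vec Z X = D.vec Z 0 + D.vec 0 X := by rw [← vec_add, add_zero, zero_add]
  rw [hsum, map_add, hZ, hX, ← hsum, ← vec_add, add_zero, zero_add]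
  rfl

/-- The homomorphism `Z ↦ (ad Z, π Z)` into the skew-symmetric derivations. -/
def derivedToHAut : derivedAlgebra 𝔤 →ₗ⁅ℝ⁆ D.hAut where
  toFun Z := ⟨D.blockDiag (LieAlgebra.ad ℝ 𝔤 Z) (D.π Z), D.blockDiag_mem_hAut_iff.2
    ⟨D.metricG_ad Z, D.metricV_π Z, fun W ↦ by rw [LieAlgebra.ad_apply, LieHom.map_lie]⟩⟩
  map_add' Z W := Subtype.ext <| D.end_ext fun V X ↦ by
    simp [blockDiag_vec, ← vec_add]
  map_smul' t Z := Subtype.ext <| D.end_ext fun V X ↦ by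
    simp [blockDiag_vec, ← vec_smul]
  map_lie' {Z W} := Subtype.ext <| D.end_ext fun V X ↦ by
    simp [blockDiag_vec, ← vec_sub, LieRing.of_associative_ring_bracket]

/-- The homomorphism `B ↦ (0, B)` into the skew-symmetric derivations. -/
def uToHAut : D.u →ₗ⁅ℝ⁆ D.hAut where
  toFun B := ⟨D.blockDiag 0 B, D.blockDiag_mem_hAut_iff.2
    ⟨by simp, (D.mem_u_iff.1 B.2).2, fun W ↦ by
      simp [LieRing.of_associative_ring_bracket, (D.mem_u_iff.1 B.2).1]⟩⟩
  map_add' B C := Subtype.ext <| D.end_ext fun V X ↦ by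
    simp [blockDiag_vec, ← vec_add]
  map_smul' t B := Subtype.ext <| D.end_ext fun V X ↦ by
    simp [blockDiag_vec, ← vec_smul]
  map_lie' {B C} := Subtype.ext <| D.end_ext fun V X ↦ by
    simp [blockDiag_vec, ← vec_sub, LieRing.of_associative_ring_bracket]

theorem lie_derivedToHAut_uToHAut (Z : derivedAlgebra 𝔤) (B : D.u) :
    ⁅D.derivedToHAut Z, D.uToHAut B⁆ = 0 :=
  Subtype.ext <| D.end_ext fun V X ↦ by
    have h := LinearMap.congr_fun ((D.mem_u_iff.1 B.2).1 Z) X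
    simp only [Module.End.mul_apply] at h
    simp [derivedToHAut, uToHAut, blockDiag_vec, LieRing.of_associative_ring_bracket, h]

/-! ### Consequences of signature one. -/

variable [FiniteDimensional ℝ 𝔳]

variable {D}

/-- Two orthogonal negative vectors would span a negative definite plane. -/
theorem IsLorentzian.nonneg_of_orthogonal (hD : D.IsLorentzian) {U W : D.Nil}
    (hUW : D.metric U W = 0) (hU : D.metric U U < 0) : 0 ≤ D.metric W W := by
  by_contra! hW
  have hsymm (U W : D.Nil) : D.metric U W = D.metric W U := by
    rw [← D.vec_equivProd U, ← D.vec_equivProd W, metric_vec, metric_vec,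
      D.metricG_symm.eq, D.metricV_symm.eq]
  have hfd : FiniteDimensional ℝ D.Nil := inferInstanceAs (FiniteDimensional ℝ (𝔤 × 𝔳))
  have hval (a c : ℝ) : D.metric (a • U + c • W) (a • U + c • W) =
      a ^ 2 * D.metric U U + c ^ 2 * D.metric W W := by
    simp only [map_add, map_smul, LinearMap.add_apply, LinearMap.smul_apply, smul_eq_mul, hUW,
      hsymm W U]
    ring
  have hneg (a c : ℝ) (h : a ≠ 0 ∨ c ≠ 0) :
      D.metric (a • U + c • W) (a • U + c • W) < 0 := by
    rw [hval]
    rcases h with h | h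
    · nlinarith [sq_pos_of_ne_zero h, sq_nonneg c, mul_neg_of_pos_of_neg (sq_pos_of_ne_zero h) hU]
    · nlinarith [sq_pos_of_ne_zero h, sq_nonneg a, mul_neg_of_pos_of_neg (sq_pos_of_ne_zero h) hW]
  have hli : LinearIndependent ℝ ![U, W] := by
    rw [LinearIndependent.pair_iff]
    intro a c h
    by_contra hne
    have := hneg a c (by tauto)
    simp [h] at this
  have hle := le_sigNeg_of_negDef D.metric.toQuadraticMap
    (V := Submodule.span ℝ (Set.range ![U, W])) (by
      rintro ⟨x, hx⟩ hx0
      rw [Matrix.range_cons_cons_empty, Submodule.mem_span_pair] at hx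
      obtain ⟨a, c, rfl⟩ := hx
      have := hneg a c (by
        by_contra! h
        exact hx0 (by ext; simp [h.1, h.2]))
      change 0 < -(D.metric (a • U + c • W) (a • U + c • W))
      linarith)
  rw [finrank_span_eq_card hli, hD] at hle
  simp at hle

theorem IsLorentzian.metricV_nonneg_of_orthogonal (hD : D.IsLorentzian) (X Y : 𝔳)
    (hXY : D.metricV X Y = 0) (hX : D.metricV X X < 0) : 0 ≤ D.metricV Y Y := by
  simpa [metric_vec] using hD.nonneg_of_orthogonal (U := D.vec 0 X) (W := D.vec 0 Y)
    (by simpa [metric_vec] using hXY) (by simpa [metric_vec] using hX)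

/-- The Lie algebra of a Lorentzian data set is compact. -/
theorem IsLorentzian.isCompactLieAlgebra (hD : D.IsLorentzian) : IsCompactLieAlgebra 𝔤 := by
  by_cases hG : ∀ Z, 0 ≤ D.metricG Z Z
  · exact ⟨D.metricG, D.metricG_symm, fun Z hZ ↦
      LinearMap.BilinForm.pos_of_nonneg D.metricG_symm D.metricG_nondegenerate hG hZ,
      D.metricG_ad⟩
  · push Not at hG
    obtain ⟨Z₀, hZ₀⟩ := hG
    -- The negative direction is used up by `Z₀`, so `𝔳` is Euclidean.
    have hV (X : 𝔳) : 0 ≤ D.metricV X X := by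
      simpa [metric_vec] using hD.nonneg_of_orthogonal (U := D.vec Z₀ 0) (W := D.vec 0 X)
        (by simp [metric_vec]) (by simpa [metric_vec] using hZ₀)
    let τ : LinearMap.BilinForm ℝ 𝔤 :=
      ((LinearMap.mul ℝ (Module.End ℝ 𝔳)).compr₂ (LinearMap.trace ℝ 𝔳)).compl₁₂
        (D.π : 𝔤 →ₗ[ℝ] Module.End ℝ 𝔳) (D.π : 𝔤 →ₗ[ℝ] Module.End ℝ 𝔳)
    have hτ (Z W : 𝔤) : τ Z W = LinearMap.trace ℝ 𝔳 (D.π Z * D.π W) := rfl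
    refine ⟨-τ, ⟨fun Z W ↦ ?_⟩, fun Z hZ ↦ ?_, fun Z Z₁ Z₂ ↦ ?_⟩
    · simp [hτ, LinearMap.trace_mul_comm ℝ (D.π Z)]
    · rw [LinearMap.neg_apply, LinearMap.neg_apply, hτ, neg_pos]
      refine LinearMap.BilinForm.trace_mul_self_neg_of_skew D.metricV_symm (fun X hX ↦
        LinearMap.BilinForm.pos_of_nonneg D.metricV_symm D.metricV_nondegenerate hV hX)
        (D.metricV_π Z) fun h0 ↦ hZ (D.faithful (by rw [h0, map_zero]))
    · simp only [LinearMap.neg_apply, hτ, LieHom.map_lie, LieRing.of_associative_ring_bracket,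
        sub_mul, mul_sub, map_sub]
      have h := LinearMap.trace_mul_comm ℝ (D.π Z) (D.π Z₁ * D.π Z₂)
      simp only [← mul_assoc] at h ⊢
      linarith

theorem IsLorentzian.apply_center_eq_zero (hD : D.IsLorentzian) {A : Module.End ℝ 𝔤}
    {B : Module.End ℝ 𝔳} (h : D.blockDiag A B ∈ D.hAut)
    (hA : ∀ x y, A ⁅x, y⁆ = ⁅A x, y⁆ + ⁅x, A y⁆) {Z : 𝔤} (hZ : Z ∈ LieAlgebra.center ℝ 𝔤) :
    A Z = 0 := by
  obtain ⟨-, -, hπ⟩ := D.blockDiag_mem_hAut_iff.1 h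
  rw [mem_center_iff] at hZ
  -- The derivation `A` preserves the center of `𝔤`.
  have hcomm (W : 𝔤) : Commute (D.π (A Z)) (D.π W) := by
    have h1 := hA W Z
    rw [hZ, hZ, map_zero, zero_add] at h1
    have h2 := congrArg D.π h1
    rw [map_zero, LieHom.map_lie, LieRing.of_associative_ring_bracket] at h2
    exact (sub_eq_zero.1 h2.symm).symm
  have hnil : IsNilpotent (D.π (A Z)) := by
    have h1 := hcomm Z
    rw [hπ, LieRing.of_associative_ring_bracket] at h1 ⊢
    exact isNilpotent_commutator_of_commute (Algebra.IsIntegral.isIntegral _) h1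
  refine D.faithful ?_
  rw [map_zero]
  refine LinearMap.BilinForm.eq_zero_of_isNilpotent_of_skew D.metricV_symm
    D.metricV_nondegenerate hD.metricV_nonneg_of_orthogonal (D.metricV_π _) hnil
    (S := Set.range D.π) ?_ ?_ ?_
  · rintro _ ⟨W, rfl⟩
    exact D.metricV_π W
  · rintro _ ⟨W, rfl⟩
    exact hcomm W
  · exact fun X hX ↦ D.eq_zero_of_forall_π fun W ↦ hX _ ⟨W, rfl⟩

/-- The `𝔤`-component of a skew-symmetric derivation of `𝔫` is inner. -/
theorem IsLorentzian.exists_eq_lie (hD : D.IsLorentzian) {A : Module.End ℝ 𝔤}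
    {B : Module.End ℝ 𝔳} (h : D.blockDiag A B ∈ D.hAut) :
    ∃ W ∈ derivedAlgebra 𝔤, ∀ Z, A Z = ⁅W, Z⁆ := by
  obtain ⟨-, -, hπ⟩ := D.blockDiag_mem_hAut_iff.1 h
  have hA (x y : 𝔤) : A ⁅x, y⁆ = ⁅A x, y⁆ + ⁅x, A y⁆ := by
    refine D.faithful ?_
    rw [hπ, map_add, LieHom.map_lie, LieHom.map_lie, LieHom.map_lie, hπ, hπ, leibniz_lie]
  exact hD.isCompactLieAlgebra.exists_eq_lie A hA fun Z hZ ↦ hD.apply_center_eq_zero h hA hZ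

theorem IsLorentzian.exists_eq_add (hD : D.IsLorentzian) (T : D.hAut) :
    ∃ Z B, T = D.derivedToHAut Z + D.uToHAut B := by
  obtain ⟨T, hT⟩ := T
  obtain ⟨A, B, rfl⟩ := D.exists_blockDiag_of_mem_hAut hT
  obtain ⟨-, hB, hπ⟩ := D.blockDiag_mem_hAut_iff.1 hT
  obtain ⟨W, hW, hA⟩ := hD.exists_eq_lie hT
  refine ⟨⟨W, hW⟩, ⟨B - D.π W, D.mem_u_iff.2 ⟨fun Z ↦ ?_, fun X Y ↦ ?_⟩⟩,
    Subtype.ext <| D.end_ext fun V X ↦ ?_⟩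
  · have h := hπ Z
    rw [hA, LieHom.map_lie, LieRing.of_associative_ring_bracket,
      LieRing.of_associative_ring_bracket] at h
    rw [mul_sub, sub_mul, ← sub_eq_zero]
    rw [← sub_eq_zero] at h
    rw [← h]
    abel
  · simp only [LinearMap.sub_apply, map_sub, hB, D.metricV_π]
    ring
  · simp [derivedToHAut, uToHAut, blockDiag_vec, ← vec_add, hA]

end DataSet

/-! ### The decomposition of `𝔥^aut`. -/

theorem mainTheorem2 {𝔤 𝔳 : Type*} [LieRing 𝔤] [LieAlgebra ℝ 𝔤] [FiniteDimensional ℝ 𝔤]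
    [AddCommGroup 𝔳] [Module ℝ 𝔳] [FiniteDimensional ℝ 𝔳]
    (D : DataSet 𝔤 𝔳) (hD : D.IsLorentzian) :
    (IsCompl (derivedAlgebra 𝔤) (LieAlgebra.center ℝ 𝔤) ∧
      LieAlgebra.IsSemisimple ℝ (derivedAlgebra 𝔤) ∧
      IsCompactLieAlgebra (derivedAlgebra 𝔤)) ∧
    ∃ (φ : derivedAlgebra 𝔤 →ₗ⁅ℝ⁆ D.hAut) (ψ : D.u →ₗ⁅ℝ⁆ D.hAut),
      (∀ (Z : derivedAlgebra 𝔤) (W : 𝔤) (X : 𝔳),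
        (φ Z : Module.End ℝ D.Nil) (D.vec W X) = D.vec ⁅(Z : 𝔤), W⁆ (D.π (Z : 𝔤) X)) ∧
      (∀ (B : D.u) (W : 𝔤) (X : 𝔳),
        (ψ B : Module.End ℝ D.Nil) (D.vec W X) = D.vec 0 ((B : Module.End ℝ 𝔳) X)) ∧
      Function.Injective φ ∧ Function.Injective ψ ∧
      ∃ I J : LieIdeal ℝ D.hAut,
        (I : Set D.hAut) = Set.range φ ∧ (J : Set D.hAut) = Set.range ψ ∧
        IsCompl I J ∧ ⁅I, J⁆ = ⊥ := by
  have hc := hD.isCompactLieAlgebra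
  refine ⟨⟨hc.isCompl, hc.isSemisimple_derivedAlgebra, hc.lieIdeal _⟩,
    D.derivedToHAut, D.uToHAut, fun _ _ _ ↦ rfl, fun _ _ _ ↦ rfl, ?_, ?_, ?_⟩
  · refine (injective_iff_map_eq_zero _).2 fun Z hZ ↦ Subtype.ext (D.faithful ?_)
    rw [LieSubmodule.coe_zero, map_zero]
    refine LinearMap.ext fun X ↦ ?_
    exact (D.vec_inj.1 (LinearMap.congr_fun (congrArg Subtype.val hZ) (D.vec 0 X))).2
  · refine (injective_iff_map_eq_zero _).2 fun B hB ↦ Subtype.ext (LinearMap.ext fun X ↦ ?_)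
    exact (D.vec_inj.1 (LinearMap.congr_fun (congrArg Subtype.val hB) (D.vec 0 X))).2
  have hcomm := D.lie_derivedToHAut_uToHAut
  -- Both images are ideals because they commute with each other and together span `D.hAut`.
  let I : LieIdeal ℝ D.hAut :=
    { __ := (D.derivedToHAut : derivedAlgebra 𝔤 →ₗ[ℝ] D.hAut).range
      lie_mem := by
        rintro T _ ⟨Z, rfl⟩
        obtain ⟨W, B, rfl⟩ := hD.exists_eq_add T
        refine ⟨⁅W, Z⁆, ?_⟩
        simp only [LieHom.coe_toLinearMap]
        rw [LieHom.map_lie, add_lie, ← lie_skew (D.uToHAut B), hcomm, neg_zero, add_zero] }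
  let J : LieIdeal ℝ D.hAut :=
    { __ := (D.uToHAut : D.u →ₗ[ℝ] D.hAut).range
      lie_mem := by
        rintro T _ ⟨C, rfl⟩
        obtain ⟨W, B, rfl⟩ := hD.exists_eq_add T
        refine ⟨⁅B, C⁆, ?_⟩
        simp only [LieHom.coe_toLinearMap]
        rw [LieHom.map_lie, add_lie, hcomm, zero_add] }
  refine ⟨I, J, rfl, rfl, ⟨?_, ?_⟩, ?_⟩
  · rw [disjoint_iff, eq_bot_iff]
    rintro _ ⟨⟨Z, rfl⟩, ⟨B, hB⟩⟩
    -- Comparing `𝔤`-blocks in `hB` gives `ad Z = 0`.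
    have hZ : (Z : 𝔤) ∈ derivedAlgebra 𝔤 ⊓ LieAlgebra.center ℝ 𝔤 := by
      rw [LieSubmodule.mem_inf]
      refine ⟨Z.2, mem_center_iff.2 fun W ↦ ?_⟩
      rw [← lie_skew, neg_eq_zero]
      exact (D.vec_inj.1 (LinearMap.congr_fun (congrArg Subtype.val hB) (D.vec W 0))).1.symm
    rw [hc.isCompl.inf_eq_bot, LieSubmodule.mem_bot] at hZ
    have hZ' : Z = 0 := Subtype.ext hZ
    rw [LieSubmodule.mem_bot, hZ', map_zero]
  · rw [codisjoint_iff, eq_top_iff]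
    intro T _
    obtain ⟨W, B, rfl⟩ := hD.exists_eq_add T
    exact (LieSubmodule.mem_sup _ _ _).2 ⟨_, ⟨W, rfl⟩, _, ⟨B, rfl⟩, rfl⟩
  · rw [LieSubmodule.lie_eq_bot_iff]
    rintro _ ⟨Z, rfl⟩ _ ⟨B, rfl⟩
    exact hcomm Z B
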